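/- **Conventions.** Write $n=\{0,\dots,n-1\}$. A *type-space functor* $S$ assigns to each $n<\omega$ a topological space $S_n$ and to each $f:n\to m$ a continuous map $Sf:S_m\to S_n$, open when $f$ is injective, with $S(g\circ f)=Sf\circ Sg$ and $S(\mathrm{id})=\mathrm{id}$, and such that the following weak amalgamation holds. Let $i_k:k\to k+1$ be the inclusion, and let $d_m:m+1\to m+2$ be given by $d_m(j)=j$ for $j<m$ and $d_m(m)=m+1$. For all $m$, $p\in S_m$, $q\in (Si_m)^{-1}(p)$ and nonempty relatively open $U\subseteq (Si_m)^{-1}(p)$, there is $r\in S_{m+2}$ with $(Si_{m+1})(r)=q$ and $(Sd_m)(r)\in U$. For a topological space $X$, the functor $S(X)$ is given by $S_n=X^n$ and $(Sf)(x_0,\dots,x_{m-1})=(x_{f(0)},\dots,x_{f(n-1)})$. Let $S_\omega=\varprojlim S_n$ along the inclusions $\iota_{n,m}:n\to m$, $n<m$. A map $f:n\to\omega$ induces $Sf:S_\omega\to S_n$ by $(Sf)(\sigma)=(Sf')(\sigma_m)$, where $m$ is such that $f$ takes values in $m$ and $f':n\to m$ is the corestriction of $f$. For $A\in[\omega]^n$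 with increasing enumeration $f_A:n\to\omega$, put $M_\sigma(A)=(Sf_A)(\sigma)$. A *countable model* is a function $M$ on the finite subsets of $\omega$ with $M(A)\in S_{|A|}$ such that, for $A=\{a_0<\dots<a_{n-1}\}$: 1. if $A\subseteq B=\{b_0<\dots<b_{m-1}\}$ and $a_i=b_{g(i)}$ for all $i<n$, then $M(A)=(Sg)(M(B))$; 2. if $m\ge n$ and $U$ is a nonempty relatively open subset of $(S\iota_{n,m})^{-1}(M(A))$, then there are $B=\{b_0<\dots<b_{m-1}\}\supseteq A$ and a permutation $g$ of $m$ with $a_i=b_{g(i)}$ for $i<n$ and $(Sg)(M(B))\in U$. Let $S_{\mathcal W}=\{\sigma\in S_\omega: M_\sigma\text{ is a countable model}\}$. Every countable model is $M_\sigma$ for a unique $\sigma\in S_{\mathcal W}$ and is identified with this $\sigma$. A model $\sigma$ *is in* (or *realizes*) $C\subseteq S_\omega$ if $\sigma\in C$, and *omits* $E\subseteq S_\omega$ if $\sigma\notin E$. * $S$ has the *strong omitting types property* if for every closed $C\subseteq S_\omega$ that contains a model, and every $E\subseteq C$ such that $E\cap S_{\mathcal W}$ is meagre in the space $C\cap S_{\mathcal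 W}$, there is a model in $C$ omitting $E$. * The *omitting types game* on a closed set $C\subseteq S_\omega$ is played by REALIZE and OMIT. They alternate, with REALIZE first, in choosing closed subsets $F_0\subseteq F_1\subseteq\cdots$ of $S_\omega$, each of which must be omitted by some model in $C$. OMIT wins if some model in $C$ omits $\bigcup_n F_n$; otherwise REALIZE wins. $S$ has the *game omitting types property* if OMIT has a winning strategy in the game on $C$ for every closed $C\subseteq S_\omega$. (If $C$ contains no model, REALIZE has no legal first move and OMIT wins.) A filter $\mathcal F$ on $\omega$ is *non-principal* if it is not of the form $\{A\subseteq\omega: K\subseteq A\}$ for any $K\subseteq\omega$ (in particular it is proper). It is viewed as a subspace of the Cantor set $2^\omega$ via characteristic functions. It is a *$P$-filter* if for all $U_0,U_1,\dots\in\mathcal F$ there is $A\in\mathcal F$ with $A\setminus U_n$ finite for every $n$, and it is *nonmeagre* if it is a nonmeagre subset of $2^\omega$. **Proposition.** Let $\mathcal F$ be a non-principal nonmeagre $P$-filter on $\omega$, viewed as a subspace of $2^\omega$. Then the type-space functor $S(\mathcal F)$ has the strong omitting types property but does not have the game omitting types property. -/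

import Mathlib

open Set Filter Topology

universe u v

/-- A type-space functor: a contravariant functor from the category of the finite sets
`n = {0, …, n-1}` and arbitrary functions to topological spaces and continuous maps, which is open
on injections and has the weak amalgamation property.

Openness is asked of `map f` for injective `f` only: for a non-injective `f` such as `2 → 1`
the map `X → X²`, `x ↦ (x, x)`, of the functor generated by a space `X` is not open unless `X` is
discrete. -/
structure TypeSpaceFunctor where
  space : ℕ → Type u
  [top : ∀ n, TopologicalSpace (space n)]
  map : ∀ {n m : ℕ}, (Fin n → Fin m) → space m → space n
  continuous_map : ∀ {n m : ℕ} (f : Fin n → Fin m), Continuous (map f)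
  isOpenMap_map : ∀ {n m : ℕ} (f : Fin n → Fin m), Function.Injective f → IsOpenMap (map f)
  map_comp : ∀ {n m k : ℕ} (f : Fin n → Fin m) (g : Fin m → Fin k),
    map (g ∘ f) = map f ∘ map g
  map_id : ∀ n : ℕ, map (id : Fin n → Fin n) = id
  /-- Here `Fin.castSucc : m → m + 1` is the inclusion, and the last map is `d : m + 1 → m + 2`
  with `d j = j` for `j < m` and `d m = m + 1`. -/
  weak_amalgamation : ∀ (m : ℕ) (p : space m) (q : space (m + 1)),
    map (Fin.castSucc : Fin m → Fin (m + 1)) q = p →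
    ∀ U : Set {q' : space (m + 1) // map (Fin.castSucc : Fin m → Fin (m + 1)) q' = p},
      IsOpen U → U.Nonempty →
      ∃ r : space (m + 2), map (Fin.castSucc : Fin (m + 1) → Fin (m + 2)) r = q ∧
        map (Fin.lastCases (Fin.last (m + 1)) (fun j : Fin m => j.castSucc.castSucc) :
          Fin (m + 1) → Fin (m + 2)) r ∈ Subtype.val '' U

namespace TypeSpaceFunctor

attribute [instance] TypeSpaceFunctor.top

variable (S : TypeSpaceFunctor.{u})

/-- The space `S_ω` of `ω`-types: the inverse limit of the spaces `S_n` along the maps induced by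
the inclusions `n → m`, a subspace of the product. -/
abbrev Omega : Type u :=
  {σ : ∀ n, S.space n // ∀ (n m : ℕ) (h : n < m), σ n = S.map (Fin.castLE h.le) (σ m)}

variable {S}

theorem Omega.eq_map (σ : S.Omega) {n m : ℕ} (h : n ≤ m) :
    σ.1 n = S.map (Fin.castLE h) (σ.1 m) := by
  rcases h.lt_or_eq with h' | rfl
  · exact σ.2 n m h'
  · have : (Fin.castLE h : Fin n → Fin n) = id := by
      funext i
      rfl
    rw [this, S.map_id]
    rfl

theorem lt_bound {n : ℕ} (f : Fin n → ℕ) (i : Fin n) : f i < Finset.univ.sup f + 1 :=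
  Nat.lt_succ_of_le (Finset.le_sup (f := f) (Finset.mem_univ i))

/-- The map `Sf : S_ω → S_n` for `f : n → ω`: corestrict `f` to some `m` that contains its image,
and apply it to the `m`-th coordinate. -/
def omegaMap {n : ℕ} (f : Fin n → ℕ) (σ : S.Omega) : S.space n :=
  S.map (fun i => (⟨f i, lt_bound f i⟩ : Fin (Finset.univ.sup f + 1)))
    (σ.1 (Finset.univ.sup f + 1))

/-- `omegaMap` does not depend on the choice of the number `m` that contains the image of `f`. -/
theorem omegaMap_eq {n : ℕ} (f : Fin n → ℕ) (σ : S.Omega) {m : ℕ} (h : ∀ i, f i < m) :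
    omegaMap f σ = S.map (fun i => (⟨f i, h i⟩ : Fin m)) (σ.1 m) := by
  have key : ∀ {k l : ℕ} (hkl : k ≤ l) (hk : ∀ i, f i < k) (hl : ∀ i, f i < l),
      S.map (fun i => (⟨f i, hk i⟩ : Fin k)) (σ.1 k)
        = S.map (fun i => (⟨f i, hl i⟩ : Fin l)) (σ.1 l) := by
    intro k l hkl hk hl
    rw [σ.eq_map hkl]
    exact (congrFun (S.map_comp (fun i => (⟨f i, hk i⟩ : Fin k)) (Fin.castLE hkl)) _).symm
  rcases le_total m (Finset.univ.sup f + 1) with hm | hm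
  · exact (key hm h (lt_bound f)).symm
  · exact key hm (lt_bound f) h

/-- `M` is a model of size `κ` for `S`. An `n`-element subset `A = {a_0 < … < a_{n-1}}` of `κ` is
given by its increasing enumeration `a : Fin n ↪o κ`, and `M a` is the value `M(A) ∈ S_n`. -/
structure IsModel {κ : Type v} [LinearOrder κ]
    (M : ∀ {n : ℕ}, (Fin n ↪o κ) → S.space n) : Prop where
  restrict : ∀ {n m : ℕ} (a : Fin n ↪o κ) (b : Fin m ↪o κ) (g : Fin n → Fin m),
    (∀ i, a i = b (g i)) → M a = S.map g (M b)
  /-- Every nonempty open subset `U` of the fibre over `M(A)` is met. -/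
  witness : ∀ {n m : ℕ} (h : n ≤ m) (a : Fin n ↪o κ)
    (U : Set {q : S.space m // S.map (Fin.castLE h) q = M a}), IsOpen U → U.Nonempty →
    ∃ b : Fin m ↪o κ, range a ⊆ range b ∧ ∃ g : Equiv.Perm (Fin m),
      (∀ i : Fin n, a i = b (g (Fin.castLE h i))) ∧ S.map g (M b) ∈ Subtype.val '' U

/-- The function `M_σ` on finite subsets of `ω`: `M_σ(A) = (S f_A)(σ)`, where `f_A` is the
increasing enumeration of `A`. -/
def toModel (σ : S.Omega) {n : ℕ} (a : Fin n ↪o ℕ) : S.space n := omegaMap a σ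

variable (S) in
/-- The subspace `S_W` of `S_ω`: those `σ` for which `M_σ` is a (countable) model. -/
def modelTypes : Set S.Omega := {σ | IsModel (S := S) (κ := ℕ) (fun a => toModel σ a)}

/-- Every countable model `M` is `M_σ` for a unique `σ`, namely `σ_n = M({0, …, n-1})`; this
justifies identifying countable models with the elements of `S_W`. -/
theorem existsUnique_toModel {M : ∀ {n : ℕ}, (Fin n ↪o ℕ) → S.space n}
    (hM : IsModel (S := S) (κ := ℕ) M) :
    ∃! σ : S.Omega, σ ∈ S.modelTypes ∧
      ∀ {n : ℕ} (a : Fin n ↪o ℕ), toModel σ a = M a := by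
  let σ : S.Omega := ⟨fun n => M (Fin.valOrderEmb n), fun n m h =>
    hM.restrict _ _ _ (fun i => rfl)⟩
  have hσ : ∀ {n : ℕ} (a : Fin n ↪o ℕ), toModel σ a = M a := fun a =>
    (hM.restrict a (Fin.valOrderEmb _) (fun i => ⟨a i, lt_bound a i⟩) (fun i => rfl)).symm
  refine ⟨σ, ⟨?_, hσ⟩, ?_⟩
  · have : (fun {n : ℕ} (a : Fin n ↪o ℕ) => toModel σ a) = @M := by
      funext n a
      exact hσ a
    change IsModel (S := S) (κ := ℕ) (fun {n : ℕ} (a : Fin n ↪o ℕ) => toModel σ a)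
    rw [this]
    exact hM
  · rintro τ ⟨-, hτ⟩
    refine Subtype.ext (funext fun n => ?_)
    have h1 := hτ (Fin.valOrderEmb n)
    have h2 := omegaMap_eq (⇑(Fin.valOrderEmb n)) τ (m := n) (fun i => i.2)
    have h3 : (fun i : Fin n => (⟨(Fin.valOrderEmb n) i, i.2⟩ : Fin n)) = id := by
      funext i
      rfl
    rw [h3, S.map_id] at h2
    exact h2.symm.trans h1

variable (S)

/-- The strong omitting types property. Countable models are identified with the elements of `S_W`;
a model `σ` is in `C` if `σ ∈ C`, and it omits `E` if `σ ∉ E`. The set `C` is required to contain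
a model, and meagreness of `E` is relative to the space `C ∩ S_W` of the models in `C`. -/
def StrongOmittingTypes : Prop :=
  ∀ C : Set S.Omega, IsClosed C → (C ∩ S.modelTypes).Nonempty →
    ∀ E : Set S.Omega, E ⊆ C →
      IsMeagre (Subtype.val ⁻¹' E : Set ↥(C ∩ S.modelTypes)) →
      ∃ σ ∈ S.modelTypes, σ ∈ C ∧ σ ∉ E

/-- The set `A` of `ω`-types is omissible in a model realizing `C`. -/
def Omissible (C A : Set S.Omega) : Prop := ∃ σ ∈ S.modelTypes, σ ∈ C ∧ σ ∉ A

/-- The moves numbered `0, …, n - 1` of the sequence `P` obey the rules of the omitting types game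
on `C`: they form an increasing chain of partial `ω`-types, each of them omissible in a model
realizing `C`. -/
def LegalUpTo (C : Set S.Omega) (P : ℕ → Set S.Omega) (n : ℕ) : Prop :=
  ∀ i < n, IsClosed (P i) ∧ S.Omissible C (P i) ∧ ∀ j < i, P j ⊆ P i

/-- `τ` is a winning strategy for OMIT in the omitting types game on `C`. REALIZE makes the moves
with even number and OMIT those with odd number; `τ` takes the finite sequence of all
earlier moves to a move. Whenever OMIT follows `τ`, OMIT obeys the rules as long as REALIZE does,
and if all moves obey the rules then the union of the moves is omissible in a model realizing
`C`. -/
def IsWinningForOmit (C : Set S.Omega) (τ : (n : ℕ) → (Fin n → Set S.Omega) → Set S.Omega) :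
    Prop :=
  ∀ P : ℕ → Set S.Omega, (∀ k, P (2 * k + 1) = τ (2 * k + 1) (fun i => P i)) →
    (∀ k, S.LegalUpTo C P (2 * k + 1) → S.LegalUpTo C P (2 * k + 2)) ∧
    ((∀ n, S.LegalUpTo C P n) → S.Omissible C (⋃ n, P n))

/-- The game omitting types property: for every partial `ω`-type (that is, closed set) `C`, OMIT
has a winning strategy in the omitting types game on `C`. -/
def GameOmittingTypes : Prop :=
  ∀ C : Set S.Omega, IsClosed C → ∃ τ, S.IsWinningForOmit C τ

/-- The type-space functor generated by a topological space `X`: `S_n = X^n`, and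
`(Sf)(x_0, …, x_{m-1}) = (x_{f(0)}, …, x_{f(n-1)})` for `f : n → m`. -/
def ofSpace (X : Type u) [TopologicalSpace X] : TypeSpaceFunctor.{u} where
  space n := Fin n → X
  map f x := x ∘ f
  continuous_map f := continuous_pi fun i => continuous_apply (f i)
  isOpenMap_map := by
    classical
    intro n m f hf
    rw [isOpenMap_iff_nhds_le]
    intro x
    let e : (Fin n → X) → (Fin m → X) := fun y j =>
      if h : ∃ i, f i = j then y h.choose else x j
    have he : Continuous e := by
      refine continuous_pi fun j => ?_
      by_cases h : ∃ i, f i = j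
      · simp only [e, dif_pos h]
        exact continuous_apply _
      · simp only [e, dif_neg h]
        exact continuous_const
    have hch : ∀ i, (⟨i, rfl⟩ : ∃ i', f i' = f i).choose = i := fun i =>
      hf (⟨i, rfl⟩ : ∃ i', f i' = f i).choose_spec
    have hinv : ∀ y, e y ∘ f = y := by
      intro y
      funext i
      have h : ∃ i', f i' = f i := ⟨i, rfl⟩
      simp only [Function.comp_apply, e, dif_pos h]
      exact congrArg y (hch i)
    have hx : e (x ∘ f) = x := by
      funext j
      by_cases h : ∃ i, f i = j
      · simp only [e, dif_pos h, Function.comp_apply]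
        exact congrArg x h.choose_spec
      · simp only [e, dif_neg h]
    intro s hs
    have h1 : e ⁻¹' ((fun z : Fin m → X => z ∘ f) ⁻¹' s) ∈ 𝓝 (x ∘ f) := by
      apply he.continuousAt
      rw [hx]
      exact hs
    refine mem_of_superset h1 fun y hy => ?_
    have h2 : e y ∘ f ∈ s := hy
    rwa [hinv] at h2
  map_comp f g := rfl
  map_id n := rfl
  weak_amalgamation := by
    rintro m p q hq U - ⟨u, hu⟩
    refine ⟨Fin.snoc (α := fun _ => X) q (u.1 (Fin.last m)), ?_, u, hu, ?_⟩
    · funext i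
      simp
    · funext j
      have h3 : ∀ j : Fin m, u.1 j.castSucc = q j.castSucc := fun j =>
        congrFun (u.2.trans hq.symm) j
      refine Fin.lastCases ?_ (fun j => ?_) j
      · simp
      · simp [h3]

end TypeSpaceFunctor

/-- The family `F` of subsets of `ω`, as a set of points of the Cantor set `2^ω`, a subset of `ω`
being identified with its characteristic function. -/
def filterPoints (F : Filter ℕ) : Set (ℕ → Bool) := {x | {n | x n = true} ∈ F}

/-- `F` is a `P`-filter: any countably many members of `F` almost include a single member. -/
def IsPFilter (F : Filter ℕ) : Prop :=
  ∀ U : ℕ → Set ℕ, (∀ n, U n ∈ F) → ∃ A ∈ F, ∀ n, (A \ U n).Finite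

/-! An `ω`-type of `S(F)` is a sequence of points of `F`, written as a double sequence of bits with
rows in `F`. It is a model exactly when it enters every nonempty open subset of `F` at arbitrarily
late indices, which amounts to countably many open conditions.

Strong omitting types therefore reduces to `F^ω` being hereditarily Baire
(`exists_mem_power_of_dense`): the dense open subsets of `C ∩ S_W` whose intersection avoids `E`
extend to open sets of `F^ω`, and a point of all of them that satisfies the model conditions and
lies in the closure of `C ∩ S_W` is as required. The danger is that the limit of a Baire category
construction leaves `F^ω`. The `P`-property supplies one element of the power almost contained in
each of the countably many points the construction may use; nonmeagreness supplies another with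
infinitely many gaps, which absorb the finite errors.

Against a winning strategy for OMIT on the whole space, REALIZE plays two runs, alternately fixing
ever longer initial segments of the first coordinate so that the two runs share only core elements
there. OMIT wins both, so two members of `F` intersect inside the core. Then the core is in `F`, and
`F` is principal. -/

/-! ### Combinatorics of nonmeagre `P`-filters -/

/-- Two double sequences agree on the square `N × N`. -/
def Agree (N : ℕ) (x y : ℕ → ℕ → Bool) : Prop := ∀ i < N, ∀ j < N, x i j = y i j

theorem Agree.refl (N : ℕ) (x : ℕ → ℕ → Bool) : Agree N x x := fun _ _ _ _ => rfl

theorem Agree.symm {N : ℕ} {x y : ℕ → ℕ → Bool} (h : Agree N x y) : Agree N y x :=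
  fun i hi j hj => (h i hi j hj).symm

theorem Agree.trans {N : ℕ} {x y z : ℕ → ℕ → Bool} (h : Agree N x y) (h' : Agree N y z) :
    Agree N x z := fun i hi j hj => (h i hi j hj).trans (h' i hi j hj)

theorem Agree.mono {M N : ℕ} {x y : ℕ → ℕ → Bool} (h : Agree N x y) (hMN : M ≤ N) :
    Agree M x y := fun i hi j hj => h i (hi.trans_le hMN) j (hj.trans_le hMN)

/-- The intersection of all members of a filter. -/
def filterCore (F : Filter ℕ) : Set ℕ := {j | ∀ s ∈ F, j ∈ s}

/-- Cofinite sets need not belong to `F`, so finite modifications are allowed only off the core: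
each point there is missed by some member. -/
theorem compl_mem_of_finite_of_disjoint_core {F : Filter ℕ} {T : Set ℕ} (hT : T.Finite)
    (h : ∀ j ∈ T, j ∉ filterCore F) : Tᶜ ∈ F := by
  have : Tᶜ = ⋂ j ∈ T, ({j}ᶜ : Set ℕ) := by
    ext i
    simp only [mem_compl_iff, mem_iInter, mem_singleton_iff]
    exact ⟨fun h k hk hik => h (hik ▸ hk), fun h hi => h i hi rfl⟩
  rw [this, Filter.biInter_mem hT]
  intro j hj
  have h1 := h j hj
  simp only [filterCore, mem_ofPred_eq, not_forall] at h1
  obtain ⟨s, hs, hjs⟩ := h1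
  exact mem_of_superset hs fun i hi hij => hjs (hij ▸ hi)

theorem eq_principal_of_core_mem {F : Filter ℕ} (h : filterCore F ∈ F) :
    F = 𝓟 (filterCore F) :=
  le_antisymm (le_principal_iff.2 h) fun s hs => mem_principal.2 fun _ hj => hj s hs

/-- The set is closed and contains no eventually zero sequence, while those are dense. -/
theorem isNowhereDense_meets_blocks {n : ℕ → ℕ} (hn : StrictMono n) (m : ℕ) :
    IsNowhereDense
      {x : ℕ → Bool | ∀ k ≥ m, ∃ j, n k ≤ j ∧ j < n (k + 1) ∧ x j = true} := by
  have hcl : IsClosed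
      {x : ℕ → Bool | ∀ k ≥ m, ∃ j, n k ≤ j ∧ j < n (k + 1) ∧ x j = true} := by
    simp only [ofPred_forall]
    refine isClosed_iInter fun k => isClosed_iInter fun _ => ?_
    have : {x : ℕ → Bool | ∃ j, n k ≤ j ∧ j < n (k + 1) ∧ x j = true}
        = ⋃ j ∈ Ico (n k) (n (k + 1)), {x : ℕ → Bool | x j = true} := by
      ext x
      simp [and_assoc]
    rw [this]
    exact (finite_Ico _ _).isClosed_biUnion fun j _ =>
      isClosed_eq (continuous_apply j) continuous_const
  rw [hcl.isNowhereDense_iff, eq_empty_iff_forall_notMem]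
  intro x hx
  let y : ℕ → ℕ → Bool := fun N j => if j < N then x j else false
  have hy : Tendsto y atTop (𝓝 x) := by
    refine tendsto_pi_nhds.2 fun j => ?_
    refine tendsto_const_nhds.congr' ?_
    filter_upwards [eventually_gt_atTop j] with N hN
    simp [y, hN]
  obtain ⟨N, hN⟩ := (hy.eventually (mem_interior_iff_mem_nhds.1 hx)).exists
  obtain ⟨j, h1, -, h2⟩ := hN (max m N) (le_max_left _ _)
  have h3 : N ≤ j := (le_max_right m N).trans (hn.le_apply.trans h1)
  simp [y, h3.not_gt] at h2

/-- Otherwise every member meets all but finitely many blocks, and countably many nowhere dense sets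
cover `F`. -/
theorem exists_mem_missing_blocks {F : Filter ℕ} (hM : ¬ IsMeagre (filterPoints F))
    {n : ℕ → ℕ} (hn : StrictMono n) :
    ∃ A ∈ F, ∃ᶠ k in atTop, ∀ j, n k ≤ j → j < n (k + 1) → j ∉ A := by
  by_contra hcon
  refine hM (IsMeagre.mono ?_ (isMeagre_iUnion fun m =>
    (isNowhereDense_meets_blocks hn m).isMeagre))
  intro x hx
  have h1 : ¬ ∃ᶠ k in atTop, ∀ j, n k ≤ j → j < n (k + 1) → j ∉ {j | x j = true} :=
    fun h => hcon ⟨_, hx, h⟩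
  rw [not_frequently, eventually_atTop] at h1
  obtain ⟨m, hm⟩ := h1
  refine mem_iUnion.2 ⟨m, fun k hk => ?_⟩
  have h2 := hm k hk
  push Not at h2
  exact h2

/-- The `ω`-th power of a nonmeagre filter is nonmeagre, in combinatorial form: some member of the
power misses, outside the core, infinitely many of the differences of given squares. -/
theorem exists_power_missing_blocks {F : Filter ℕ} (hM : ¬ IsMeagre (filterPoints F))
    {n : ℕ → ℕ} (hn : StrictMono n) :
    ∃ A : ℕ → Set ℕ, (∀ i, A i ∈ F) ∧ ∃ᶠ k in atTop, ∀ i j, i < n (k + 1) → j < n (k + 1) →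
      ¬ (i < n k ∧ j < n k) → j ∈ A i → j ∈ filterCore F := by
  obtain ⟨A, hA, hmiss⟩ := exists_mem_missing_blocks hM hn
  have hex : ∀ i, ∃ k, i < n k := fun i => ⟨i + 1, hn.le_apply⟩
  classical
  -- Row `i` also drops the non-core points below the first endpoint exceeding `i`. This clears the
  -- part of the `k`-th difference with `n k ≤ i`; the part with `i < n k` lies over a block that
  -- `A` misses.
  refine ⟨fun i => A ∩ {j | j < n (Nat.find (hex i)) ∧ j ∉ filterCore F}ᶜ,
    fun i => inter_mem hA (compl_mem_of_finite_of_disjoint_core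
      ((finite_lt_nat (n (Nat.find (hex i)))).subset fun j hj => hj.1) fun j hj => hj.2),
    hmiss.mono fun k hk i j hi hj hij hjA => ?_⟩
  by_contra hjK
  have h1 : n (Nat.find (hex i)) ≤ j := not_lt.1 fun h => hjA.2 ⟨h, hjK⟩
  by_cases hik : i < n k
  · exact hk j (not_lt.1 fun h => hij ⟨hik, h⟩) hj hjA.1
  · have h2 : k < Nat.find (hex i) := by
      by_contra h
      exact hik ((Nat.find_spec (hex i)).trans_le (hn.monotone (not_lt.1 h)))
    have := hn.monotone (show k + 1 ≤ _ from h2)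
    omega

/-- The `ω`-th power of a `P`-filter is a `P`-filter. -/
theorem IsPFilter.exists_power_pseudointersection {F : Filter ℕ} (hP : IsPFilter F)
    {ι : Type*} [Countable ι] [Nonempty ι] (y : ι → ℕ → ℕ → Bool)
    (hy : ∀ a i, y a i ∈ filterPoints F) :
    ∃ A : ℕ → Set ℕ, (∀ i, A i ∈ F) ∧ ∀ a, ∃ m, ∀ i j, ¬ (i < m ∧ j < m) → j ∈ A i →
      y a i j = true := by
  obtain ⟨e, he⟩ := exists_surjective_nat ι
  obtain ⟨B, hB, hfin⟩ := hP
    (fun p => {j | y (e p.unpair.1) p.unpair.2 j = true}) (fun p => hy _ _)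
  -- Rows `i ≥ n` then lie inside the `n`-th point entirely, and each of the finitely many earlier
  -- rows has finitely many exceptions.
  refine ⟨fun i => B ∩ ⋂ n ∈ Iic i, {j | y (e n) i j = true}, fun i => inter_mem hB
    ((Filter.biInter_mem (finite_Iic i)).2 fun n _ => hy _ _), fun a => ?_⟩
  obtain ⟨n, rfl⟩ := he a
  have hT : (⋃ i ∈ Iio n, B \ {j | y (e n) i j = true}).Finite := by
    refine (finite_Iio n).biUnion fun i _ => ?_
    simpa using hfin (Nat.pair n i)
  obtain ⟨m, hm⟩ := hT.bddAbove
  refine ⟨max n (m + 1), fun i j hij hj => ?_⟩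
  rcases le_or_gt n i with h | h
  · exact mem_iInter₂.1 hj.2 n h
  · by_contra hne
    have : j ≤ m := hm (mem_iUnion₂.2 ⟨i, h, hj.1, hne⟩)
    exact hij ⟨lt_max_of_lt_left h, lt_max_of_lt_right (by omega)⟩

/-- The `ω`-th power of a nonmeagre `P`-filter is hereditarily Baire: if `Y` is a nonempty subset
of the power, and the sets `H n` are relatively open and dense in `Y`, then the closure of `Y` in
the power meets `⋂ n, H n`. -/
theorem exists_mem_power_of_dense {F : Filter ℕ} (hP : IsPFilter F)
    (hM : ¬ IsMeagre (filterPoints F)) {Y : Set (ℕ → ℕ → Bool)} (hYne : Y.Nonempty)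
    (hY : ∀ y ∈ Y, ∀ i, y i ∈ filterPoints F) (H : ℕ → Set (ℕ → ℕ → Bool))
    (hH : ∀ n, ∀ y ∈ Y, ∀ N, ∃ y' ∈ Y, Agree N y y' ∧
      ∃ N', ∀ z, (∀ i, z i ∈ filterPoints F) → Agree N' y' z → z ∈ H n) :
    ∃ z, (∀ i, z i ∈ filterPoints F) ∧ (∀ N, ∃ y ∈ Y, Agree N z y) ∧ ∀ n, z ∈ H n := by
  classical
  obtain ⟨y₀, hy₀⟩ := hYne
  let res : (N : ℕ) → (ℕ → ℕ → Bool) → (Fin N → Fin N → Bool) := fun N y i j => y i j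
  have hres : ∀ {N : ℕ} {y y' : ℕ → ℕ → Bool}, res N y = res N y' → Agree N y y' :=
    fun h i hi j hj => congrFun (congrFun h ⟨i, hi⟩) ⟨j, hj⟩
  have hD : ∀ (N n : ℕ) (p : Fin N → Fin N → Bool), ∃ d ∈ Y, ∃ N',
      (∃ y ∈ Y, res N y = p) → (∀ y, res N y = p → Agree N y d) ∧
        ∀ z, (∀ i, z i ∈ filterPoints F) → Agree N' d z → z ∈ H n := by
    intro N n p
    by_cases h : ∃ y ∈ Y, res N y = p
    · obtain ⟨y, hy, hyp⟩ := h
      obtain ⟨y', hy', hag, N', hN'⟩ := hH n y hy N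
      exact ⟨y', hy', N', fun _ => ⟨fun w hw => (hres (hw.trans hyp.symm)).trans hag, hN'⟩⟩
    · exact ⟨y₀, hy₀, 0, fun h' => absurd h' h⟩
  choose D hDY o hDo using hD
  obtain ⟨A, hAF, hA⟩ := hP.exists_power_pseudointersection
    (fun a : Σ N : ℕ, ℕ × (Fin N → Fin N → Bool) => D a.1 a.2.1 a.2.2) (fun a => hY _ (hDY _ _ _))
  choose m hm using hA
  let h : ℕ → ℕ := fun N => Finset.univ.sup
    fun a : Fin (N + 1) × (Fin N → Fin N → Bool) => max (o N a.1 a.2) (m ⟨N, a.1, a.2⟩)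
  have hh : ∀ N n p, n ≤ N → o N n p ≤ h N ∧ m ⟨N, n, p⟩ ≤ h N := fun N n p hn => by
    have := Finset.le_sup (f := fun a : Fin (N + 1) × (Fin N → Fin N → Bool) =>
      max (o N a.1 a.2) (m ⟨N, a.1, a.2⟩)) (Finset.mem_univ (⟨n, Nat.lt_succ_of_le hn⟩, p))
    exact max_le_iff.1 this
  let n : ℕ → ℕ := fun k => Nat.rec 0 (fun _ N => max (N + 1) (h N)) k
  have hnsucc : ∀ k, n (k + 1) = max (n k + 1) (h (n k)) := fun k => rfl
  have hn : StrictMono n := strictMono_nat_of_lt_succ fun k => by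
    rw [hnsucc]
    exact lt_max_of_lt_left (Nat.lt_succ_self _)
  obtain ⟨B, hBF, hB⟩ := exists_power_missing_blocks hM hn
  obtain ⟨φ, hφ, hφB⟩ := extraction_of_frequently_atTop hB
  -- Stage `k` fixes the square `N k`, whose surrounding ring up to `n (φ k + 1)` is missed by `B`
  -- off the core.
  let N : ℕ → ℕ := fun k => n (φ k)
  have hN : StrictMono N := hn.comp hφ
  let y : ℕ → ℕ → ℕ → Bool := fun k => Nat.rec y₀ (fun k y => D (N k) k (res (N k) y)) k
  have hysucc : ∀ k, y (k + 1) = D (N k) k (res (N k) (y k)) := fun k => rfl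
  have hyY : ∀ k, y k ∈ Y := by
    rintro (_ | k)
    · exact hy₀
    · exact hDY _ _ _
  have hstep : ∀ k, Agree (N k) (y k) (y (k + 1)) := fun k =>
    (hDo _ _ _ ⟨y k, hyY k, rfl⟩).1 _ rfl
  have hlong : ∀ k l, k ≤ l → Agree (N k) (y k) (y l) := by
    intro k l hkl
    induction l, hkl using Nat.le_induction with
    | base => exact Agree.refl _ _
    | succ l hl ih => exact ih.trans ((hstep l).mono (hN.monotone hl))
  -- By stage `max i j + 1` the entry `(i, j)` lies in the square that no longer changes.
  let z : ℕ → ℕ → Bool := fun i j => y (max i j + 1) i j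
  have hz : ∀ k, Agree (N k) z (y k) := by
    intro k i hi j hj
    have h1 : ∀ a ≤ max i j, a < N (max i j + 1) := fun a ha =>
      (Nat.lt_succ_of_le ha).trans_le hN.le_apply
    rcases le_total k (max i j + 1) with hk | hk
    · exact ((hlong _ _ hk) i hi j hj).symm
    · exact (hlong _ _ hk) i (h1 i (le_max_left _ _)) j (h1 j (le_max_right _ _))
  have hnext : ∀ k, n (φ k + 1) ≤ N (k + 1) := fun k =>
    hn.monotone (hφ (Nat.lt_succ_self k))
  have hzF : ∀ i, z i ∈ filterPoints F := by
    intro i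
    refine mem_of_superset (inter_mem (inter_mem (hAF i) (hBF i)) (hY y₀ hy₀ i)) ?_
    rintro j ⟨⟨hjA, hjB⟩, hj0⟩
    have hex : ∃ k, i < N k ∧ j < N k := ⟨max i j + 1,
      (Nat.lt_succ_of_le (le_max_left i j)).trans_le hN.le_apply,
      (Nat.lt_succ_of_le (le_max_right i j)).trans_le hN.le_apply⟩
    obtain ⟨k', ⟨hi, hj⟩, hmin⟩ : ∃ k, (i < N k ∧ j < N k) ∧ ∀ l < k, ¬ (i < N l ∧ j < N l) :=
      by
      obtain ⟨k, hk, hmin⟩ := WellFounded.has_min wellFounded_lt {k | i < N k ∧ j < N k} hex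
      exact ⟨k, hk, fun l hl h => hmin l h hl⟩
    -- Take the first square `N k'` containing `(i, j)`. For `k' = 0` the bit is that of `y₀`.
    -- Otherwise, in the ring up to `n (φ k + 1)` membership in `B i` puts `j` in the core; beyond
    -- it `A i` is contained in row `i` of `y (k + 1)`.
    rw [mem_ofPred_eq, hz _ i hi j hj]
    rcases k' with _ | k
    · exact hj0
    · have hik := hmin k (Nat.lt_succ_self k)
      by_cases hblock : i < n (φ k + 1) ∧ j < n (φ k + 1)
      · exact hφB k i j hblock.1 hblock.2 hik hjB _ (hY _ (hyY (k + 1)) i)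
      · refine hm ⟨N k, k, res (N k) (y k)⟩ i j (fun hlt => hblock ?_) hjA
        have h1 := (hh (N k) k (res (N k) (y k)) hN.le_apply).2
        have h2 : h (N k) ≤ n (φ k + 1) := le_max_right _ _
        exact ⟨hlt.1.trans_le (h1.trans h2), hlt.2.trans_le (h1.trans h2)⟩
  refine ⟨z, hzF, fun k => ⟨y k, hyY k, (hz k).mono hN.le_apply⟩, fun k => ?_⟩
  refine (hDo (N k) k (res (N k) (y k)) ⟨y k, hyY k, rfl⟩).2 z hzF ?_
  refine Agree.mono (hz (k + 1)).symm (le_trans ?_ (hnext k))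
  exact (hh (N k) k (res (N k) (y k)) hN.le_apply).1.trans (le_max_right _ _)

/-! ### The models of the functor generated by a filter -/

namespace TypeSpaceFunctor

section Coordinates

variable {X : Type u} [TopologicalSpace X]

/-- The sequence of points of `X` that corresponds to an `ω`-type of `ofSpace X`. -/
def coord (σ : (ofSpace X).Omega) (i : ℕ) : X :=
  (σ.1 (i + 1) : Fin (i + 1) → X) (Fin.last i)

theorem apply_eq_coord (σ : (ofSpace X).Omega) (n : ℕ) (i : Fin n) :
    (σ.1 n : Fin n → X) i = coord σ i :=
  (congrFun (σ.eq_map (Nat.succ_le_of_lt i.2)) (Fin.last (i : ℕ))).symm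

/-- The `ω`-type of `ofSpace X` that corresponds to a sequence of points of `X`. -/
def ofCoord (x : ℕ → X) : (ofSpace X).Omega :=
  ⟨fun _ i => x i, fun _ _ _ => rfl⟩

theorem toModel_eq (σ : (ofSpace X).Omega) {n : ℕ} (a : Fin n ↪o ℕ) :
    toModel σ a = fun i => coord σ (a i) :=
  funext fun _ => apply_eq_coord σ _ _

theorem continuous_coord (i : ℕ) : Continuous fun σ : (ofSpace X).Omega => coord σ i :=
  (continuous_apply (A := fun _ : Fin (i + 1) => X) (Fin.last i)).comp
    ((continuous_apply (A := (ofSpace X).space) (i + 1)).comp continuous_subtype_val)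

theorem tendsto_of_coord {α : Type*} {l : Filter α} {s : α → (ofSpace X).Omega}
    {σ : (ofSpace X).Omega} (h : ∀ i, Tendsto (fun a => coord (s a) i) l (𝓝 (coord σ i))) :
    Tendsto s l (𝓝 σ) := by
  rw [tendsto_subtype_rng, tendsto_pi_nhds]
  intro n
  refine (tendsto_pi_nhds (A := fun _ : Fin n => X)).2 fun i => ?_
  simp only [apply_eq_coord]
  exact h i

end Coordinates

variable {F : Filter ℕ}

/-- The double sequence of bits of an `ω`-type of the functor generated by a filter. -/
def bits (σ : (ofSpace ↥(filterPoints F)).Omega) (i j : ℕ) : Bool := (coord σ i).1 j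

theorem bits_mem (σ : (ofSpace ↥(filterPoints F)).Omega) (i : ℕ) : bits σ i ∈ filterPoints F :=
  (coord σ i).2

theorem exists_bits_eq {z : ℕ → ℕ → Bool} (hz : ∀ i, z i ∈ filterPoints F) :
    ∃ σ : (ofSpace ↥(filterPoints F)).Omega, bits σ = z :=
  ⟨ofCoord fun i => ⟨z i, hz i⟩, rfl⟩

theorem tendsto_of_agree {s : ℕ → (ofSpace ↥(filterPoints F)).Omega}
    {σ : (ofSpace ↥(filterPoints F)).Omega} (h : ∀ N, Agree N (bits σ) (bits (s N))) :
    Tendsto s atTop (𝓝 σ) := by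
  refine tendsto_of_coord fun i => tendsto_subtype_rng.2 (tendsto_pi_nhds.2 fun j => ?_)
  refine tendsto_const_nhds.congr' ?_
  filter_upwards [eventually_gt_atTop i, eventually_gt_atTop j] with N hi hj
  exact h N i hi j hj

theorem exists_agree_subset {U : Set (ofSpace ↥(filterPoints F)).Omega} (hU : IsOpen U)
    {σ : (ofSpace ↥(filterPoints F)).Omega} (hσ : σ ∈ U) :
    ∃ N, ∀ σ', Agree N (bits σ) (bits σ') → σ' ∈ U := by
  by_contra! hcon
  choose s hs hsU using hcon
  obtain ⟨N, hN⟩ := ((tendsto_of_agree hs).eventually (hU.mem_nhds hσ)).exists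
  exact hsU N hN

theorem continuous_bits (i j : ℕ) :
    Continuous fun σ : (ofSpace ↥(filterPoints F)).Omega => bits σ i j :=
  (continuous_apply j).comp (continuous_subtype_val.comp (continuous_coord i))

theorem isOpen_agree_row (i N : ℕ) (x : ℕ → Bool) :
    IsOpen {σ : (ofSpace ↥(filterPoints F)).Omega | ∀ j < N, bits σ i j = x j} := by
  have : {σ : (ofSpace ↥(filterPoints F)).Omega | ∀ j < N, bits σ i j = x j}
      = ⋂ j ∈ Iio N, {σ | bits σ i j = x j} := by
    ext σ
    simp
  rw [this]
  exact (finite_Iio N).isOpen_biInter fun j _ =>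
    (isOpen_discrete {x j}).preimage (continuous_bits i j)

theorem isOpen_agree (N : ℕ) (x : ℕ → ℕ → Bool) :
    IsOpen {σ : (ofSpace ↥(filterPoints F)).Omega | Agree N x (bits σ)} := by
  have : {σ : (ofSpace ↥(filterPoints F)).Omega | Agree N x (bits σ)}
      = ⋂ i ∈ Iio N, {σ | ∀ j < N, bits σ i j = x i j} := by
    ext σ
    simp [Agree, eq_comm]
  rw [this]
  exact (finite_Iio N).isOpen_biInter fun i _ => isOpen_agree_row i N (x i)

theorem exists_pattern_subset {m : ℕ} {V : Set (Fin m → ↥(filterPoints F))} (hV : IsOpen V)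
    {u : Fin m → ↥(filterPoints F)} (hu : u ∈ V) :
    ∃ N, ∀ q : Fin m → ↥(filterPoints F), (∀ k, ∀ j < N, (q k).1 j = (u k).1 j) → q ∈ V := by
  by_contra! hcon
  choose s hs hsV using hcon
  have : Tendsto s atTop (𝓝 u) := by
    refine tendsto_pi_nhds.2 fun k => tendsto_subtype_rng.2 (tendsto_pi_nhds.2 fun j => ?_)
    refine tendsto_const_nhds.congr' ?_
    filter_upwards [eventually_gt_atTop j] with N hj
    exact (hs N k j hj).symm
  obtain ⟨N, hN⟩ := (this.eventually (hV.mem_nhds hu)).exists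
  exact hsV N hN

/-- The witness property is applied over `{0, …, M-1}` with one new point close to `x`; injectivity
makes the new index at least `M`. -/
theorem exists_late_of_mem_modelTypes {σ : (ofSpace ↥(filterPoints F)).Omega}
    (hσ : σ ∈ (ofSpace ↥(filterPoints F)).modelTypes) {x : ℕ → Bool} (hx : x ∈ filterPoints F)
    (N M : ℕ) : ∃ i ≥ M, ∀ j < N, bits σ i j = x j := by
  let a : Fin M ↪o ℕ := Fin.valOrderEmb M
  let fib := {q : Fin (M + 1) → ↥(filterPoints F) //
    q ∘ Fin.castLE (Nat.le_succ M) = toModel σ a}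
  let U : Set fib := {q | ∀ j < N, (q.1 (Fin.last M)).1 j = x j}
  have hU : IsOpen U := by
    have : U = ⋂ j ∈ Iio N, {q : fib | (q.1 (Fin.last M)).1 j = x j} := by
      ext q
      simp [U]
    rw [this]
    refine (finite_Iio N).isOpen_biInter fun j _ => (isOpen_discrete {x j}).preimage ?_
    exact (continuous_apply j).comp (continuous_subtype_val.comp
      ((continuous_apply (Fin.last M)).comp continuous_subtype_val))
  have hne : U.Nonempty := by
    refine ⟨⟨Fin.snoc (α := fun _ => ↥(filterPoints F)) (toModel σ a) ⟨x, hx⟩, ?_⟩, ?_⟩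
    · funext i
      exact Fin.snoc_castSucc (α := fun _ => ↥(filterPoints F)) _ _ i
    · intro j _
      have h1 := Fin.snoc_last (α := fun _ => ↥(filterPoints F)) ⟨x, hx⟩ (toModel σ a)
      exact congrFun (congrArg Subtype.val h1) j
  obtain ⟨b, -, g, hg, q, hq, hqb⟩ := hσ.witness (Nat.le_succ M) a U hU hne
  refine ⟨b (g (Fin.last M)), ?_, fun j hj => ?_⟩
  · by_contra! hlt
    have h1 : b (g (Fin.last M)) = b (g (Fin.castLE (Nat.le_succ M) ⟨_, hlt⟩)) := hg ⟨_, hlt⟩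
    have h2 := congrArg Fin.val (g.injective (b.injective h1))
    simp only [Fin.val_last, Fin.val_castLE] at h2
    omega
  · have h1 := hq j hj
    rw [hqb, toModel_eq] at h1
    exact h1

/-- New coordinates are approximated one at a time at ever later indices, which keeps them distinct
from each other and from `a`. -/
theorem mem_modelTypes_of_exists_late {σ : (ofSpace ↥(filterPoints F)).Omega}
    (hσ : ∀ x ∈ filterPoints F, ∀ N M, ∃ i ≥ M, ∀ j < N, bits σ i j = x j) :
    σ ∈ (ofSpace ↥(filterPoints F)).modelTypes := by
  refine ⟨fun a b g hab => ?_, fun {n m} hnm a U hU hne => ?_⟩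
  · simp only [toModel_eq]
    funext i
    exact congrArg (coord σ) (hab i)
  · obtain ⟨⟨u, hua⟩, huU⟩ := hne
    obtain ⟨V, hV, rfl⟩ := isOpen_induced_iff.1 hU
    obtain ⟨N, hN⟩ := exists_pattern_subset hV huU
    have hua' : ∀ i, u (Fin.castLE hnm i) = coord σ (a i) := fun i => by
      have := congrFun hua i
      rw [toModel_eq] at this
      exact this
    have hpick : ∀ (k M : ℕ), ∃ i ≥ M, ∀ hk : k < m, ∀ j < N, bits σ i j = (u ⟨k, hk⟩).1 j := by
      intro k M
      by_cases hk : k < m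
      · obtain ⟨i, hi, h⟩ := hσ _ (u ⟨k, hk⟩).2 N M
        exact ⟨i, hi, fun _ => h⟩
      · exact ⟨M, le_rfl, fun h => absurd h hk⟩
    choose pick hpickM hpick using hpick
    let d : ℕ → ℕ := fun k => Nat.rec (Finset.univ.sup a + 1) (fun k M => pick k M + 1) k
    have hdsucc : ∀ k, d (k + 1) = pick k (d k) + 1 := fun k => rfl
    have hd : StrictMono d := strictMono_nat_of_lt_succ fun k => by
      rw [hdsucc]
      exact Nat.lt_succ_of_le (hpickM k (d k))
    let c : Fin m → ℕ := fun k => if hk : (k : ℕ) < n then a ⟨k, hk⟩ else pick k (d k)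
    have hlt : ∀ (i : Fin n) (k : ℕ), a i < pick k (d k) := fun i k =>
      (lt_bound a i).trans_le ((hd.monotone (Nat.zero_le k)).trans (hpickM k (d k)))
    have hpinj : StrictMono fun k => pick k (d k) := strictMono_nat_of_lt_succ fun k =>
      lt_of_lt_of_le (Nat.lt_succ_self _) (hpickM (k + 1) (d (k + 1)))
    have hc : Function.Injective c := by
      intro k l hkl
      simp only [c] at hkl
      split_ifs at hkl with hk hl hl
      · have := congrArg Fin.val (a.injective hkl)
        exact Fin.ext this
      · exact absurd hkl (hlt _ _).ne
      · exact absurd hkl (hlt _ _).ne'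
      · exact Fin.ext (hpinj.injective hkl)
    have hca : ∀ i, c (Fin.castLE hnm i) = a i := fun i => by simp [c]
    have hsort : StrictMono (c ∘ Tuple.sort c) :=
      (Tuple.monotone_sort c).strictMono_of_injective (hc.comp (Tuple.sort c).injective)
    have hb : ∀ k, (OrderEmbedding.ofStrictMono _ hsort) ((Tuple.sort c)⁻¹ k) = c k := fun k => by
      simp
    refine ⟨OrderEmbedding.ofStrictMono _ hsort, ?_, (Tuple.sort c)⁻¹, fun i => ?_, ?_⟩
    · rintro _ ⟨i, rfl⟩
      exact ⟨_, (hb _).trans (hca i)⟩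
    · rw [hb, hca]
    · have hmap : (ofSpace ↥(filterPoints F)).map ((Tuple.sort c)⁻¹ : Equiv.Perm (Fin m))
          (toModel σ (OrderEmbedding.ofStrictMono _ hsort)) = fun k => coord σ (c k) := by
        rw [toModel_eq]
        funext k
        exact congrArg (coord σ) (hb k)
      rw [hmap]
      refine ⟨⟨fun k => coord σ (c k), ?_⟩, hN _ fun k j hj => ?_, rfl⟩
      · rw [toModel_eq]
        funext i
        exact congrArg (coord σ) (hca i)
      · change bits σ (c k) j = (u k).1 j
        by_cases hk : (k : ℕ) < n
        · have h1 : c k = a ⟨k, hk⟩ := by simp [c, hk]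
          rw [h1]
          exact (congrArg (fun x => x.1 j) (hua' ⟨k, hk⟩)).symm
        · have h1 : c k = pick k (d k) := by simp [c, hk]
          rw [h1]
          exact hpick k (d k) k.2 j hj

theorem exists_mem_modelTypes (F : Filter ℕ) :
    ∃ σ, σ ∈ (ofSpace ↥(filterPoints F)).modelTypes := by
  have hrep : ∀ p : Σ N : ℕ, Fin N → Bool, ∃ r ∈ filterPoints F,
      ∀ x ∈ filterPoints F, (∀ j : Fin p.1, x j = p.2 j) → ∀ j : Fin p.1, r j = x j := by
    intro p
    by_cases h : ∃ x ∈ filterPoints F, ∀ j : Fin p.1, x j = p.2 j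
    · obtain ⟨r, hr, hrp⟩ := h
      exact ⟨r, hr, fun x _ hxp j => (hrp j).trans (hxp j).symm⟩
    · refine ⟨fun _ => true, by simp [filterPoints], fun x hx hxp => absurd ⟨x, hx, hxp⟩ h⟩
  choose r hrF hr using hrep
  obtain ⟨e, he⟩ := exists_surjective_nat (Σ N : ℕ, Fin N → Bool)
  obtain ⟨σ, hσ⟩ := exists_bits_eq (F := F) (z := fun i => r (e i.unpair.1)) (fun i => hrF _)
  refine ⟨σ, mem_modelTypes_of_exists_late fun x hx N M => ?_⟩
  obtain ⟨k, hk⟩ := he ⟨N, fun j => x j⟩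
  -- Pairing repeats every pattern infinitely often.
  refine ⟨Nat.pair k M, Nat.right_le_pair k M, fun j hj => ?_⟩
  simp only [hσ, Nat.unpair_pair, hk]
  exact hr ⟨N, fun j => x j⟩ x hx (fun _ => rfl) ⟨j, hj⟩

/-! ### Strong omitting types from the hereditary Baire property -/

theorem strongOmittingTypes_ofFilter (hP : IsPFilter F) (hM : ¬ IsMeagre (filterPoints F)) :
    (ofSpace ↥(filterPoints F)).StrongOmittingTypes := by
  intro C hC hne E _ hE
  obtain ⟨T, hTo, hTd, hTc, hTE⟩ := mem_residual_iff.1 hE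
  have : Countable ↥T := hTc.to_subtype
  choose! V hVo hV using fun t (ht : t ∈ T) => isOpen_induced_iff.1 (hTo t ht)
  let ι := ↥T ⊕ (Σ N : ℕ, (Fin N → Bool) × ℕ)
  -- The left summand encodes the dense open sets, the right one the conditions for being a model,
  -- one for each finite pattern and lower bound on the index.
  let H : ι → Set (ℕ → ℕ → Bool) := Sum.elim
    (fun t => {z | ∀ σ : (ofSpace ↥(filterPoints F)).Omega, bits σ = z → σ ∈ V t})
    (fun p => {z | ∀ x ∈ filterPoints F, (∀ j : Fin p.1, x j = p.2.1 j) →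
      ∃ i ≥ p.2.2, ∀ j : Fin p.1, z i j = x j})
  have : Nonempty ι := ⟨Sum.inr ⟨0, finZeroElim, 0⟩⟩
  obtain ⟨e, he⟩ := exists_surjective_nat ι
  obtain ⟨z, hzF, hzC, hzH⟩ := exists_mem_power_of_dense hP hM
    (Y := bits '' (C ∩ (ofSpace ↥(filterPoints F)).modelTypes)) (hne.image _)
    (by rintro _ ⟨σ, -, rfl⟩ i; exact bits_mem σ i) (fun n => H (e n)) (by
      rintro n _ ⟨σ, hσ, rfl⟩ N
      rcases e n with ⟨t, ht⟩ | ⟨K, p, M⟩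
      · obtain ⟨⟨σ', hσ'⟩, h1, h2⟩ := (hTd t ht).inter_open_nonempty
          (Subtype.val ⁻¹' {σ' | Agree N (bits σ) (bits σ')})
          ((isOpen_agree N (bits σ)).preimage continuous_subtype_val) ⟨⟨σ, hσ⟩, Agree.refl _ _⟩
        have h3 : σ' ∈ V t := by
          rw [← hV t ht] at h2
          exact h2
        obtain ⟨N', hN'⟩ := exists_agree_subset (hVo t ht) h3
        exact ⟨_, ⟨σ', hσ', rfl⟩, h1, N', fun z _ hz τ hτ => hN' τ (hτ ▸ hz)⟩
      · refine ⟨_, ⟨σ, hσ, rfl⟩, Agree.refl _ _, ?_⟩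
        by_cases hp : ∃ x ∈ filterPoints F, ∀ j : Fin K, x j = p j
        · obtain ⟨x, hx, hxp⟩ := hp
          obtain ⟨i, hi, hix⟩ := exists_late_of_mem_modelTypes hσ.2 hx K M
          refine ⟨max (i + 1) K, fun z _ hz y _ hyp => ⟨i, hi, fun j => ?_⟩⟩
          rw [← hz i (lt_max_of_lt_left (Nat.lt_succ_self i)) j (lt_max_of_lt_right j.2),
            hix j j.2, hxp j, hyp j]
        · exact ⟨0, fun z _ _ y hy hyp => absurd ⟨y, hy, hyp⟩ hp⟩)
  obtain ⟨σ, rfl⟩ := exists_bits_eq hzF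
  have hσC : σ ∈ C := by
    by_contra hσ
    obtain ⟨N, hN⟩ := exists_agree_subset hC.isOpen_compl hσ
    obtain ⟨_, ⟨τ, hτ, rfl⟩, hag⟩ := hzC N
    exact hN τ hag hτ.1
  have hall : ∀ a, bits σ ∈ H a := fun a => by
    obtain ⟨n, rfl⟩ := he a
    exact hzH n
  have hσW : σ ∈ (ofSpace ↥(filterPoints F)).modelTypes :=
    mem_modelTypes_of_exists_late fun x hx N M => by
      obtain ⟨i, hi, h⟩ := hall (Sum.inr ⟨N, fun j => x j, M⟩) x hx fun _ => rfl
      exact ⟨i, hi, fun j hj => h ⟨j, hj⟩⟩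
  refine ⟨σ, hσW, hσC, fun hσE => ?_⟩
  have h1 : (⟨σ, hσC, hσW⟩ : ↥(C ∩ (ofSpace ↥(filterPoints F)).modelTypes)) ∈ ⋂₀ T := by
    intro t ht
    rw [← hV t ht]
    exact hall (Sum.inl ⟨t, ht⟩) σ rfl
  exact hTE h1 hσE

/-! ### The omitting types game -/

section Game

variable {S : TypeSpaceFunctor.{u}}
  (τ : (n : ℕ) → (Fin n → Set S.Omega) → Set S.Omega)

/-- The first `n` moves of the game in which OMIT follows `τ` and REALIZE plays the sets `R k`. -/
def playPrefix (R : ℕ → Set S.Omega) : (n : ℕ) → Fin n → Set S.Omega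
  | 0 => finZeroElim
  | n + 1 => Fin.snoc (α := fun _ => Set S.Omega) (playPrefix R n)
      (if Even n then R (n / 2) else τ n (playPrefix R n))

/-- The moves of the game in which OMIT follows `τ` and REALIZE plays the sets `R k`. -/
def play (R : ℕ → Set S.Omega) (n : ℕ) : Set S.Omega :=
  if Even n then R (n / 2) else τ n (playPrefix τ R n)

theorem playPrefix_eq (R : ℕ → Set S.Omega) (n : ℕ) :
    playPrefix τ R n = fun i : Fin n => play τ R i := by
  induction n with
  | zero => exact funext finZeroElim
  | succ n ih =>
    funext i
    refine Fin.lastCases ?_ (fun i => ?_) i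
    · simp [playPrefix, play]
    · simp [playPrefix, ih]

theorem play_even (R : ℕ → Set S.Omega) (k : ℕ) : play τ R (2 * k) = R k := by
  simp [play]

theorem play_odd (R : ℕ → Set S.Omega) (k : ℕ) :
    play τ R (2 * k + 1) = τ (2 * k + 1) (fun i => play τ R i) := by
  rw [play, if_neg (by simp), playPrefix_eq]

theorem play_congr {R R' : ℕ → Set S.Omega} {k : ℕ} (h : ∀ i < k, R i = R' i) (n : ℕ)
    (hn : n < 2 * k) : play τ R n = play τ R' n := by
  induction n using Nat.strong_induction_on with
  | _ n ih =>
    rcases Nat.even_or_odd' n with ⟨l, rfl | rfl⟩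
    · rw [play_even, play_even, h l (by omega)]
    · rw [play_odd, play_odd]
      congr 1
      funext i
      exact ih i i.2 (i.2.trans hn)

theorem LegalUpTo.congr {C : Set S.Omega} {P P' : ℕ → Set S.Omega} {n : ℕ}
    (hP : S.LegalUpTo C P n) (h : ∀ i < n, P i = P' i) : S.LegalUpTo C P' n := by
  intro i hi
  obtain ⟨h1, h2, h3⟩ := hP i hi
  rw [← h i hi]
  exact ⟨h1, h2, fun j hj => h j (hj.trans hi) ▸ h3 j hj⟩

/-- The `ω`-types that have not been excluded in the first `k` rounds. -/
def remaining (k : ℕ) (R : ℕ → Set S.Omega) : Set S.Omega :=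
  {σ | ∀ i < 2 * k, σ ∉ play τ R i}

variable {τ}

theorem isOpen_remaining {C : Set S.Omega} {k : ℕ} {R : ℕ → Set S.Omega}
    (h : S.LegalUpTo C (play τ R) (2 * k)) : IsOpen (remaining τ k R) := by
  have : remaining τ k R = ⋂ i ∈ Iio (2 * k), (play τ R i)ᶜ := by
    ext σ
    simp [remaining]
  rw [this]
  exact (finite_Iio _).isOpen_biInter fun i hi => (h i hi).1.isOpen_compl

/-- The last legal move contains all earlier ones, so a model omitting it has survived every move.
-/
theorem exists_mem_remaining {C : Set S.Omega} (hC : ∃ σ ∈ S.modelTypes, σ ∈ C) {k : ℕ}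
    {R : ℕ → Set S.Omega} (h : S.LegalUpTo C (play τ R) (2 * k)) :
    ∃ σ ∈ S.modelTypes, σ ∈ C ∧ σ ∈ remaining τ k R := by
  rcases k with _ | k
  · obtain ⟨σ, hσ, hσC⟩ := hC
    exact ⟨σ, hσ, hσC, fun i hi => absurd hi (by omega)⟩
  · obtain ⟨-, ⟨σ, hσ, hσC, hσP⟩, hmono⟩ := h (2 * k + 1) (by omega)
    refine ⟨σ, hσ, hσC, fun i hi hσi => hσP ?_⟩
    rcases (show i ≤ 2 * k + 1 by omega).lt_or_eq with hlt | rfl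
    · exact hmono i hlt hσi
    · exact hσi

/-- REALIZE can shrink the set of remaining `ω`-types to any neighbourhood of a model. -/
theorem IsWinningForOmit.exists_extend {C : Set S.Omega} (hτ : S.IsWinningForOmit C τ) {k : ℕ}
    {R : ℕ → Set S.Omega} (h : S.LegalUpTo C (play τ R) (2 * k)) {ρ : S.Omega}
    (hρ : ρ ∈ S.modelTypes) (hρC : ρ ∈ C) (hρU : ρ ∈ remaining τ k R) {W : Set S.Omega}
    (hW : IsOpen W) (hρW : ρ ∈ W) :
    ∃ R', (∀ i < k, R' i = R i) ∧ S.LegalUpTo C (play τ R') (2 * (k + 1)) ∧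
      remaining τ (k + 1) R' ⊆ W := by
  classical
  -- This move is closed, contains all earlier moves and is omitted by `ρ`.
  let R' := Function.update R k (W ∩ remaining τ k R)ᶜ
  have hR' : ∀ i < k, R' i = R i := fun i hi => Function.update_of_ne hi.ne _ _
  have hplay := play_congr τ hR'
  have hlast : play τ R' (2 * k) = (W ∩ remaining τ k R)ᶜ := by
    rw [play_even]
    exact Function.update_self _ _ _
  refine ⟨R', hR', (hτ (play τ R') (play_odd τ R')).1 k ?_, fun σ hσ => ?_⟩
  · have h' := h.congr fun i hi => (hplay i hi).symm
    intro i hi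
    rcases (show i ≤ 2 * k by omega).lt_or_eq with hlt | rfl
    · exact h' i hlt
    · rw [hlast]
      refine ⟨(hW.inter (isOpen_remaining h)).isClosed_compl,
        ⟨ρ, hρ, hρC, fun hn => hn ⟨hρW, hρU⟩⟩, fun j hj σ hσj hσ => hσ.2 j hj ?_⟩
      rwa [← hplay j hj]
  · have h1 := hσ (2 * k) (by omega)
    rw [hlast, notMem_compl_iff] at h1
    exact h1.1

/-- The limit of a chain of positions in which OMIT follows a winning strategy. -/
theorem IsWinningForOmit.exists_mem_iInter {C : Set S.Omega} (hτ : S.IsWinningForOmit C τ)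
    (R : ℕ → ℕ → Set S.Omega) (hR : ∀ k, ∀ i < k, R (k + 1) i = R k i)
    (hl : ∀ k, S.LegalUpTo C (play τ (R k)) (2 * k)) :
    ∃ σ ∈ S.modelTypes, σ ∈ C ∧ ∀ k, σ ∈ remaining τ k (R k) := by
  have hlim : ∀ k, ∀ i < k, R k i = R (i + 1) i := by
    intro k i hi
    induction k, hi using Nat.le_induction with
    | base => rfl
    | succ k hk ih => rw [hR k i hk, ih]
  have hplay : ∀ k, ∀ i < 2 * k, play τ (R k) i = play τ (fun i => R (i + 1) i) i :=
    fun k => play_congr τ (hlim k)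
  -- The positions cohere, so the diagonal `R (i + 1) i` is a full run extending them all.
  obtain ⟨σ, hσ, hσC, hσP⟩ := (hτ _ (play_odd τ fun i => R (i + 1) i)).2 fun n i hi =>
    (hl n).congr (hplay n) i (by omega)
  refine ⟨σ, hσ, hσC, fun k i hi hσi => hσP (mem_iUnion.2 ⟨i, ?_⟩)⟩
  rwa [← hplay k i hi]

end Game

/-! ### Two interleaved runs against one strategy -/

variable {F : Filter ℕ}

/-- One of two simultaneous runs of the game on the space of all `ω`-types, with a model in the
set of remaining `ω`-types and a radius of a square neighbourhood contained in it. -/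
structure MarkedRun (τ : (n : ℕ) → (Fin n → Set (ofSpace ↥(filterPoints F)).Omega) →
    Set (ofSpace ↥(filterPoints F)).Omega) where
  round : ℕ
  moves : ℕ → Set (ofSpace ↥(filterPoints F)).Omega
  legal : (ofSpace ↥(filterPoints F)).LegalUpTo univ (play τ moves) (2 * round)
  mark : (ofSpace ↥(filterPoints F)).Omega
  mark_mem : mark ∈ (ofSpace ↥(filterPoints F)).modelTypes
  radius : ℕ
  subset : ∀ σ, Agree radius (bits mark) (bits σ) → σ ∈ remaining τ round moves

/-- Below `N`, the first coordinates of `σ` and `ρ` have no common elements outside the core. -/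
def DisjointBelow (N : ℕ) (σ ρ : (ofSpace ↥(filterPoints F)).Omega) : Prop :=
  ∀ j < N, bits σ 0 j = true → bits ρ 0 j = true → j ∈ filterCore F

/-- Changing the first coordinate of a model beyond `N` to make it disjoint below `M` from a given
model. -/
theorem exists_disjointBelow {σ ρ : (ofSpace ↥(filterPoints F)).Omega} {N : ℕ} (M : ℕ)
    (hσ : σ ∈ (ofSpace ↥(filterPoints F)).modelTypes) (h : DisjointBelow N σ ρ) :
    ∃ σ' ∈ (ofSpace ↥(filterPoints F)).modelTypes, Agree N (bits σ) (bits σ') ∧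
      DisjointBelow M σ' ρ := by
  classical
  -- Between `N` and `M` only the core is kept, so `x` loses at most finitely many non-core points
  -- of the old row.
  let x : ℕ → Bool := fun j => if j < N then bits σ 0 j else
    if j < M then decide (j ∈ filterCore F) else true
  have hx : x ∈ filterPoints F := by
    have hT : {j | j < M ∧ j ∉ filterCore F}ᶜ ∈ F := compl_mem_of_finite_of_disjoint_core
      ((finite_lt_nat M).subset fun j hj => hj.1) fun j hj => hj.2
    refine mem_of_superset (inter_mem (bits_mem σ 0) hT) ?_
    rintro j ⟨h1, h2⟩
    simp only [mem_compl_iff, mem_ofPred_eq, not_and, not_not] at h1 h2 ⊢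
    simp only [x]
    split_ifs with h3 h4
    · exact h1
    · exact decide_eq_true (h2 h4)
    · rfl
  obtain ⟨σ', hσ'⟩ := exists_bits_eq (F := F) (z := fun i => if i = 0 then x else bits σ i)
    fun i => by
      by_cases hi : i = 0
      · simpa [hi] using hx
      · simpa [hi] using bits_mem σ i
  refine ⟨σ', mem_modelTypes_of_exists_late fun y hy K L => ?_, fun i hi j hj => ?_, fun j hj => ?_⟩
  -- The bound `L + 1` avoids row `0`, the only one changed.
  · obtain ⟨i, hi, hiy⟩ := exists_late_of_mem_modelTypes hσ hy K (L + 1)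
    refine ⟨i, by omega, fun j hj => ?_⟩
    rw [hσ', ← hiy j hj]
    simp [show i ≠ 0 by omega]
  · rw [hσ']
    by_cases h0 : i = 0
    · simp [h0, x, hj]
    · simp [h0]
  · rw [hσ']
    intro h1 h2
    simp only [if_true, x] at h1
    split_ifs at h1 with h3
    · exact h j h3 h1 h2
    · exact of_decide_eq_true h1

theorem not_gameOmittingTypes_ofFilter (hF : ∀ s : Set ℕ, F ≠ 𝓟 s) :
    ¬ (ofSpace ↥(filterPoints F)).GameOmittingTypes := by
  intro hG
  obtain ⟨τ, hτ⟩ := hG univ isClosed_univ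
  obtain ⟨μ, hμ⟩ := exists_mem_modelTypes F
  -- The first component is the run about to move; after each step the roles are exchanged.
  let State := {s : MarkedRun τ × MarkedRun τ //
    s.1.radius ≤ s.2.radius ∧ DisjointBelow s.1.radius s.1.mark s.2.mark}
  let run₀ : MarkedRun τ := ⟨0, fun _ => ∅, fun i hi => absurd hi (by omega), μ, hμ, 0,
    fun σ _ i hi => absurd hi (by omega)⟩
  have hstep : ∀ s : State, ∃ t : State, t.1.1 = s.1.2 ∧ s.1.2.radius < t.1.2.radius ∧
      t.1.2.round = s.1.1.round + 1 ∧ (∀ i < s.1.1.round, t.1.2.moves i = s.1.1.moves i) ∧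
      ∀ σ ∈ remaining τ t.1.2.round t.1.2.moves, ∀ j < s.1.1.radius,
        bits σ 0 j = bits s.1.1.mark 0 j := by
    rintro ⟨⟨a, b⟩, hab, hdisj⟩
    -- The new mark `ρ` stays within the radius of `a`, hence remains, and is disjoint from `b.mark`
    -- off the core up to the larger radius of `b`. REALIZE then freezes row `0` up to that radius.
    obtain ⟨ρ, hρ, hag, hρb⟩ := exists_disjointBelow b.radius a.mark_mem hdisj
    obtain ⟨R, hR, hleg, hsub⟩ := hτ.exists_extend a.legal hρ (mem_univ _) (a.subset ρ hag)
      (isOpen_agree_row 0 b.radius (bits ρ 0)) (fun j _ => rfl)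
    obtain ⟨ν, hν, -, hνU⟩ := exists_mem_remaining ⟨μ, hμ, mem_univ _⟩ hleg
    obtain ⟨N, hN⟩ := exists_agree_subset (isOpen_remaining hleg) hνU
    refine ⟨⟨⟨b, ⟨a.round + 1, R, hleg, ν, hν, max N (b.radius + 1),
      fun σ hσ => hN σ (hσ.mono (le_max_left _ _))⟩⟩, ?_, ?_⟩, rfl, ?_, rfl, hR, ?_⟩
    · exact (Nat.le_succ _).trans (le_max_right _ _)
    · intro j hj h1 h2
      refine hρb j hj ?_ h1
      rw [← hsub hνU j hj]
      exact h2
    · exact lt_max_of_lt_right (Nat.lt_succ_self _)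
    · intro σ hσ j hj
      rw [hsub hσ j (hj.trans_le hab)]
      exact (hag 0 (Nat.zero_lt_of_lt hj) j hj).symm
  choose next hn1 hn2 hn3 hn4 hn5 using hstep
  -- Even terms are successive positions of one run, odd terms those of the other.
  obtain ⟨a, h0, h1, hrad, hdisj, hround, hmoves, hagree⟩ : ∃ a : ℕ → MarkedRun τ,
      (a 0).round = 0 ∧ (a 1).round = 0 ∧
      (∀ n, n ≤ (a (n + 1)).radius ∧ (a n).radius ≤ (a (n + 1)).radius) ∧
      (∀ n, DisjointBelow (a n).radius (a n).mark (a (n + 1)).mark) ∧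
      (∀ n, (a (n + 2)).round = (a n).round + 1) ∧
      (∀ n, ∀ i < (a n).round, (a (n + 2)).moves i = (a n).moves i) ∧
      ∀ n, ∀ σ ∈ remaining τ (a (n + 2)).round (a (n + 2)).moves, ∀ j < (a n).radius,
        bits σ 0 j = bits (a n).mark 0 j := by
    let s : ℕ → State := fun n => Nat.rec
      ⟨⟨run₀, run₀⟩, le_rfl, fun j hj => absurd hj (Nat.not_lt_zero j)⟩ (fun _ => next) n
    have hs : ∀ n, (s (n + 1)).1.1 = (s n).1.2 := fun n => hn1 (s n)
    have hrad : ∀ n, n ≤ (s n).1.2.radius := by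
      intro n
      induction n with
      | zero => exact Nat.zero_le _
      | succ n ih => exact Nat.succ_le_of_lt (ih.trans_lt (hn2 (s n)))
    refine ⟨fun n => (s n).1.1, rfl, congrArg MarkedRun.round (hs 0), fun n => ?_, fun n => ?_,
      fun n => ?_, fun n => ?_, fun n => ?_⟩ <;> beta_reduce
    · exact hs n ▸ ⟨hrad n, (s n).2.1⟩
    · exact hs n ▸ (s n).2.2
    · exact (congrArg MarkedRun.round (hs (n + 1))).trans (hn3 (s n))
    · exact hs (n + 1) ▸ hn4 (s n)
    · exact hs (n + 1) ▸ hn5 (s n)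
  have hchain : ∀ e, (a e).round = 0 → ∃ σ : (ofSpace ↥(filterPoints F)).Omega,
      ∀ k, ∀ j < (a (2 * k + e)).radius, bits σ 0 j = bits (a (2 * k + e)).mark 0 j := by
    intro e he
    have hsucc : ∀ k, 2 * (k + 1) + e = 2 * k + e + 2 := fun k => by ring
    have hr : ∀ k, (a (2 * k + e)).round = k := by
      intro k
      induction k with
      | zero => simpa using he
      | succ k ih => rw [hsucc, hround, ih]
    obtain ⟨σ, -, -, hσ⟩ := hτ.exists_mem_iInter (fun k => (a (2 * k + e)).moves)
      (fun k i hi => by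
        rw [hsucc]
        exact hmoves _ i ((hr k).symm ▸ hi))
      (fun k => by
        have := (a (2 * k + e)).legal
        rwa [hr k] at this)
    refine ⟨σ, fun k => hagree (2 * k + e) σ ?_⟩
    have := hσ (k + 1)
    rw [hsucc] at this
    rwa [hround, hr k]
  obtain ⟨σ, hσ⟩ := hchain 0 h0
  obtain ⟨ρ, hρ⟩ := hchain 1 h1
  -- The limits agree on row `0` with the marks up to unbounded radii, so their first coordinates
  -- meet only in the core.
  refine hF _ (eq_principal_of_core_mem (mem_of_superset
    (inter_mem (bits_mem σ 0) (bits_mem ρ 0)) ?_))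
  rintro j ⟨hj1, hj2⟩
  have hrad1 : j < (a (2 * (j + 1))).radius :=
    lt_of_lt_of_le (by omega) (hrad (2 * j + 1)).1
  refine hdisj _ j hrad1 ?_ ?_
  · exact (hσ (j + 1) j hrad1).symm.trans hj1
  · exact (hρ (j + 1) j (hrad1.trans_le (hrad _).2)).symm.trans hj2

end TypeSpaceFunctor

theorem mainTheorem6 (F : Filter ℕ) (hF : ∀ s : Set ℕ, F ≠ 𝓟 s) (hP : IsPFilter F)
    (hM : ¬ IsMeagre (filterPoints F)) :
    (TypeSpaceFunctor.ofSpace ↥(filterPoints F)).StrongOmittingTypes ∧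
      ¬ (TypeSpaceFunctor.ofSpace ↥(filterPoints F)).GameOmittingTypes :=
  ⟨TypeSpaceFunctor.strongOmittingTypes_ofFilter hP hM,
    TypeSpaceFunctor.not_gameOmittingTypes_ofFilter hF⟩
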